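/- Let $\mathcal P=\mathbb R[k^{(m)}:m\ge 0]$ be the differential algebra of polynomials in $k$ and its derivatives, with total derivative $D_s$ ($D_sk^{(m)}=k^{(m+1)}$), and let $\mathcal P_0\subset\mathcal P$ be the polynomials without constant term. $D_s^{-1}$ denotes the formal integral with zero integration constant: $D_s^{-1}p$ is defined when $p\in D_s(\mathcal P)$, and is then the unique $q\in\mathcal P_0$ with $D_sq=p$. For $a\in\mathcal P$ let $\partial_a$ be the derivation with $\partial_ak^{(m)}=D_s^ma$, let $\mathrm{der}^*(\mathcal P)=\{\partial_a\}$, and let $\mathcal R$ be the mKdV recursion operator on $\mathrm{der}^*(\mathcal P)$, $\mathcal R\,\partial_a=\partial_{(D_s^2+k^2+k_sD_s^{-1}k)a}$, defined when $ka\in D_s(\mathcal P)$. Let $I\subset\mathbb R$ be an interval with non-empty interior and $\Lambda_0$ the space of smooth arc-length parametrized curves $\gamma:I\to\mathbb R^2$, with Frenet frame $T,N$ and (signed) curvature $k$. Let $\mathfrak X_{\mathcal A}(\Lambda_0)$ be the space of vector fields $V=fT+gN$ on $\Lambda_0$ whose components satisfy $f_\gamma\in\mathcal P_0$, $g_\gamma\in\mathcal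 P$ and $f_\gamma=D_s^{-1}(kg_\gamma)$ for every $\gamma$. Put $\varphi_V=g'+kf$ and $V(k)=\varphi_V'$; $V$ acts on $\mathcal P$ as the derivation $\partial_{V(k)}$, and with $D_V(fT+gN)=(V(f)-g\varphi_V)T+(V(g)+f\varphi_V)N$ the bracket $[V,W]=D_VW-D_WV$ makes $\mathfrak X_{\mathcal A}(\Lambda_0)$ a Lie algebra. For each $\gamma$ let $\Phi_\gamma(V_\gamma)=\partial_{V_\gamma(k)}$, which is injective, and let $\bar{\mathcal R}$ be the operator on $\mathfrak X_{\mathcal A}(\Lambda_0)$ $$(\bar{\mathcal R}V)(\gamma)=(\Phi_\gamma^{-1}\mathcal R\,\Phi_\gamma)(V_\gamma),$$ on its natural domain $\mathrm{dom}\,\bar{\mathcal R}$, the set of all $V$ for which the right-hand side is defined for every $\gamma$. For a partially defined operator $R$ on a Lie algebra, $(L_\xi R)\eta=[\xi,R\eta]-R[\xi,\eta]$, and sums and compositions have their natural domains. Theorem. (i) $V\in\mathrm{dom}\,\bar{\mathcal R}$ if and only if $k\,V_\gamma(k)\in D_s(\mathcal P)$ for every $\gamma$. (ii) $\bar{\mathcal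 R}$ is a recursion operator for the planar filament vector field $V_{S_0}=\frac12k^2T+k'N$: $L_{V_{S_0}}\bar{\mathcal R}$ is defined on all of $\mathrm{dom}\,\bar{\mathcal R}$ and vanishes there. (iii) $\bar{\mathcal R}$ is hereditary: $L_{\bar{\mathcal R}V}\bar{\mathcal R}=\bar{\mathcal R}\circ L_V\bar{\mathcal R}$ for all $V\in\mathrm{dom}\,\bar{\mathcal R}$, with equal domains. Moreover, for all $V,W\in\mathrm{dom}\,\bar{\mathcal R}$, the fields $[V,W]$ and $[\bar{\mathcal R}V,W]+[V,\bar{\mathcal R}W]-\bar{\mathcal R}[V,W]$ lie in $\mathrm{dom}\,\bar{\mathcal R}$, and $$[\bar{\mathcal R}V,\bar{\mathcal R}W]=\bar{\mathcal R}\big([\bar{\mathcal R}V,W]+[V,\bar{\mathcal R}W]-\bar{\mathcal R}[V,W]\big).$$ (iv) The planar filament hierarchy $V_0=V_{S_0}$, $V_{n+1}=\bar{\mathcal R}V_n$ is well defined in $\mathfrak X_{\mathcal A}(\Lambda_0)$ for all $n\ge0$ (every $V_n$ lies in $\mathrm{dom}\,\bar{\mathcal R}$); for all $n,m$ one has $L_{V_n}\bar{\mathcal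 R}=0$ on $\mathrm{dom}\,\bar{\mathcal R}$ and $[V_n,V_m]=0$, and the $V_n$ are linearly independent over $\mathbb R$. -/

import Mathlib

open scoped ContDiff

noncomputable section

namespace PlanarFilament

/-! ### The differential algebra `𝒫 = ℝ[k, k', k'', …]` -/

/-- The polynomial algebra `𝒫 = ℝ[k⁽ᵐ⁾ : m ∈ ℕ]`; the variable `X m` stands for `k⁽ᵐ⁾`. -/
abbrev Jet : Type := MvPolynomial ℕ ℝ

/-- The generator `k⁽ᵐ⁾`. -/
abbrev kd (m : ℕ) : Jet := MvPolynomial.X m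

/-- The total derivative `D_s`, the derivation with `D_s k⁽ᵐ⁾ = k⁽ᵐ⁺¹⁾`. -/
def Ds : Derivation ℝ Jet Jet := MvPolynomial.mkDerivation ℝ fun m => kd (m + 1)

/-- `𝒫₀`: the elements of `𝒫` with vanishing constant term. -/
def jetZero : Submodule ℝ Jet := LinearMap.ker (MvPolynomial.lcoeff ℝ (0 : ℕ →₀ ℕ))

theorem Ds_kd (m : ℕ) : Ds (kd m) = kd (m + 1) := MvPolynomial.mkDerivation_X _ _ _

theorem mem_jetZero {p : Jet} : p ∈ jetZero ↔ MvPolynomial.constantCoeff p = 0 := Iff.rfl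

/-- A derivation of `𝒫` maps `𝒫` into `𝒫₀` as soon as it maps the generators there. -/
theorem derivation_mem_jetZero (d : Derivation ℝ Jet Jet) (h : ∀ m, d (kd m) ∈ jetZero)
    (p : Jet) : d p ∈ jetZero := by
  induction p using MvPolynomial.induction_on with
  | C a => rw [MvPolynomial.derivation_C]; exact jetZero.zero_mem
  | add p q hp hq => rw [map_add]; exact jetZero.add_mem hp hq
  | mul_X p n hp =>
    have h1 := h n
    rw [mem_jetZero] at *
    rw [Derivation.leibniz]
    simp [hp, h1]

theorem Ds_mem_jetZero (p : Jet) : Ds p ∈ jetZero := by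
  refine derivation_mem_jetZero Ds (fun m => ?_) p
  rw [Ds_kd, mem_jetZero]
  simp

theorem pderiv_Ds (m : ℕ) (p : Jet) :
    MvPolynomial.pderiv (m + 1) (Ds p)
      = MvPolynomial.pderiv m p + Ds (MvPolynomial.pderiv (m + 1) p) := by
  have h : ⁅(MvPolynomial.pderiv (m + 1) : Derivation ℝ Jet Jet), Ds⁆ = MvPolynomial.pderiv m := by
    refine MvPolynomial.derivation_ext fun i => ?_
    rw [Derivation.commutator_apply]
    change MvPolynomial.pderiv (m + 1) (Ds (kd i)) - _ = _
    rw [Ds_kd, MvPolynomial.pderiv_X, MvPolynomial.pderiv_X, MvPolynomial.pderiv_X]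
    by_cases h1 : i = m <;> by_cases h2 : i = m + 1 <;> simp [h1, h2]
  have h' := congrArg (fun d => d p) h
  simp only [Derivation.commutator_apply] at h'
  rw [← h']; ring

theorem pderiv_zero_Ds (p : Jet) :
    MvPolynomial.pderiv 0 (Ds p) = Ds (MvPolynomial.pderiv 0 p) := by
  have h : ⁅(MvPolynomial.pderiv 0 : Derivation ℝ Jet Jet), Ds⁆ = 0 := by
    refine MvPolynomial.derivation_ext fun i => ?_
    rw [Derivation.commutator_apply]
    change MvPolynomial.pderiv 0 (Ds (kd i)) - _ = _
    rw [Ds_kd, MvPolynomial.pderiv_X, MvPolynomial.pderiv_X]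
    by_cases h1 : i = 0 <;> simp [h1]
  have h' := congrArg (fun d => d p) h
  simp only [Derivation.commutator_apply, Derivation.coe_zero, Pi.zero_apply] at h'
  exact sub_eq_zero.mp h'

theorem pderiv_eq_zero_of_Ds {p : Jet} (h : Ds p = 0) (m : ℕ) : MvPolynomial.pderiv m p = 0 := by
  by_contra hm
  have step : ∀ j, MvPolynomial.pderiv (m + j) p ≠ 0 := by
    intro j
    induction j with
    | zero => exact hm
    | succ j ih =>
      intro h0
      apply ih
      have := pderiv_Ds (m + j) p
      rw [h, map_zero] at this
      rw [show m + j + 1 = m + (j + 1) by ring, h0, map_zero, add_zero] at this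
      exact this.symm
  apply step (p.vars.sup id + 1)
  refine MvPolynomial.pderiv_eq_zero_of_notMem_vars fun hmem => ?_
  have := Finset.le_sup (f := id) hmem
  simp only [id] at this
  omega

theorem eq_zero_of_Ds {p : Jet} (h : Ds p = 0) (h0 : p ∈ jetZero) : p = 0 := by
  ext t
  rw [MvPolynomial.coeff_zero]
  by_cases ht : t = 0
  · subst ht; exact h0
  · obtain ⟨i, hi⟩ := Finsupp.ne_iff.mp ht
    rw [Finsupp.coe_zero, Pi.zero_apply] at hi
    have h1 := MvPolynomial.coeff_pderiv (i := i) p (t - Finsupp.single i 1)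
    rw [pderiv_eq_zero_of_Ds h, MvPolynomial.coeff_zero] at h1
    have h2 : t - Finsupp.single i 1 + Finsupp.single i 1 = t := by
      ext j
      by_cases hj : i = j
      · subst hj; simp; omega
      · simp [hj]
    rw [h2] at h1
    have h3 : (((t - Finsupp.single i 1 : ℕ →₀ ℕ) i : ℝ) + 1) ≠ 0 := by positivity
    rcases mul_eq_zero.mp h1.symm with h4 | h4
    · exact h4
    · exact absurd h4 (by exact_mod_cast h3)

/-! ### Partially defined operators -/

/-- The inverse of an injective linear map, as a partial operator defined on its range. -/
def invPMap {E F : Type*} [AddCommGroup E] [Module ℝ E] [AddCommGroup F] [Module ℝ F]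
    (f : E →ₗ[ℝ] F) (hf : Function.Injective f) : F →ₗ.[ℝ] E where
  domain := LinearMap.range f
  toFun := (LinearEquiv.ofInjective f hf).symm.toLinearMap

/-- The composition `g ∘ f` of partial operators with its natural domain
`{x ∈ dom f : f x ∈ dom g}`. -/
def compP {E F G : Type*} [AddCommGroup E] [Module ℝ E] [AddCommGroup F] [Module ℝ F]
    [AddCommGroup G] [Module ℝ G] (g : F →ₗ.[ℝ] G) (f : E →ₗ.[ℝ] F) : E →ₗ.[ℝ] G where
  domain :=
    { carrier := {x | ∃ h : x ∈ f.domain, f ⟨x, h⟩ ∈ g.domain}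
      zero_mem' := ⟨f.domain.zero_mem, by
        rw [show (⟨0, f.domain.zero_mem⟩ : f.domain) = 0 from rfl, LinearPMap.map_zero]
        exact g.domain.zero_mem⟩
      add_mem' := by
        rintro x y ⟨hx, hx'⟩ ⟨hy, hy'⟩
        exact ⟨f.domain.add_mem hx hy, by
          have := g.domain.add_mem hx' hy'
          rwa [← LinearPMap.map_add] at this⟩
      smul_mem' := by
        rintro c x ⟨hx, hx'⟩
        exact ⟨f.domain.smul_mem c hx, by
          have := g.domain.smul_mem c hx'
          rwa [← LinearPMap.map_smul] at this⟩ }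
  toFun :=
    { toFun := fun x => g ⟨f ⟨x.1, x.2.1⟩, x.2.2⟩
      map_add' := fun x y => by
        rw [← LinearPMap.map_add]
        congr 1
        exact Subtype.ext (LinearPMap.map_add f ⟨x.1, x.2.1⟩ ⟨y.1, y.2.1⟩)
      map_smul' := fun c x => by
        rw [RingHom.id_apply, ← LinearPMap.map_smul]
        congr 1
        exact Subtype.ext (LinearPMap.map_smul f c ⟨x.1, x.2.1⟩) }

/-- The Lie derivative `L_ξ R` of a partial operator `R` on a Lie algebra,
`(L_ξ R) η = [ξ, R η] - R [ξ, η]`, with its natural domain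
`{η ∈ dom R : [ξ, η] ∈ dom R}`. -/
def lieDeriv {L : Type*} [LieRing L] [LieAlgebra ℝ L] (ξ : L) (R : L →ₗ.[ℝ] L) :
    L →ₗ.[ℝ] L where
  domain := R.domain ⊓ R.domain.comap (LieAlgebra.ad ℝ L ξ : L →ₗ[ℝ] L)
  toFun :=
    { toFun := fun η => ⁅ξ, R ⟨η.1, η.2.1⟩⁆ - R ⟨⁅ξ, η.1⁆, η.2.2⟩
      map_add' := fun x y => by
        have h1 : R ⟨(x + y).1, (x + y).2.1⟩ = R ⟨x.1, x.2.1⟩ + R ⟨y.1, y.2.1⟩ :=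
          LinearPMap.map_add R ⟨x.1, x.2.1⟩ ⟨y.1, y.2.1⟩
        have h2 : R ⟨⁅ξ, (x + y).1⁆, (x + y).2.2⟩
            = R ⟨⁅ξ, x.1⁆, x.2.2⟩ + R ⟨⁅ξ, y.1⁆, y.2.2⟩ := by
          rw [← LinearPMap.map_add]
          congr 1
          exact Subtype.ext (lie_add ξ x.1 y.1)
        rw [h1, h2, lie_add]
        abel
      map_smul' := fun c x => by
        have h1 : R ⟨(c • x).1, (c • x).2.1⟩ = c • R ⟨x.1, x.2.1⟩ :=
          LinearPMap.map_smul R c ⟨x.1, x.2.1⟩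
        have h2 : R ⟨⁅ξ, (c • x).1⁆, (c • x).2.2⟩ = c • R ⟨⁅ξ, x.1⁆, x.2.2⟩ := by
          rw [← LinearPMap.map_smul]
          congr 1
          exact Subtype.ext (lie_smul c ξ x.1)
        rw [h1, h2, lie_smul, RingHom.id_apply, smul_sub] }

/-- `R` is a recursion operator for `ξ`: `L_ξ R` is defined and zero on the whole of `dom R`. -/
def IsRecursionOperator {L : Type*} [LieRing L] [LieAlgebra ℝ L] (ξ : L) (R : L →ₗ.[ℝ] L) :
    Prop :=
  lieDeriv ξ R = (0 : L →ₗ[ℝ] L).toPMap R.domain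

/-- `R` is hereditary: `L_{R ξ} R = R ∘ L_ξ R` for every `ξ ∈ dom R`, as an equality of partial
operators (equal natural domains and equal values). -/
def IsHereditary {L : Type*} [LieRing L] [LieAlgebra ℝ L] (R : L →ₗ.[ℝ] L) : Prop :=
  ∀ ξ : R.domain, lieDeriv (R ξ) R = compP R (lieDeriv (ξ : L) R)

/-- The Nijenhuis torsion of `R` vanishes: for all `ξ, η ∈ dom R`, both `[ξ, η]` and
`[R ξ, η] + [ξ, R η] - R [ξ, η]` lie in `dom R`, and `R` maps the latter to `[R ξ, R η]`. -/
def NijenhuisTorsionVanishes {L : Type*} [LieRing L] [LieAlgebra ℝ L] (R : L →ₗ.[ℝ] L) : Prop :=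
  ∀ ξ η : R.domain, ∃ h : ⁅(ξ : L), (η : L)⁆ ∈ R.domain,
    ∃ h' : ⁅R ξ, (η : L)⁆ + ⁅(ξ : L), R η⁆ - R ⟨⁅(ξ : L), (η : L)⁆, h⟩ ∈ R.domain,
      R ⟨_, h'⟩ = ⁅R ξ, R η⁆

/-! ### The formal integral, derivation vector fields and the mKdV recursion operator -/

theorem Ds_injective : Function.Injective (Ds.toLinearMap.domRestrict jetZero) := by
  rw [← LinearMap.ker_eq_bot, LinearMap.ker_eq_bot']
  intro p hp
  exact Subtype.ext (eq_zero_of_Ds hp p.2)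

/-- The formal integral `D_s⁻¹`, with zero integration constant: it is defined on the total
derivatives, and `D_s⁻¹ p` is the unique `q ∈ 𝒫₀` with `D_s q = p`. -/
def DsInv : Jet →ₗ.[ℝ] Jet :=
  jetZero.subtype.compPMap (invPMap (Ds.toLinearMap.domRestrict jetZero) Ds_injective)

/-- The derivation vector field `∂_a`, given by `∂_a k⁽ᵐ⁾ = D_sᵐ a`. -/
def evol (a : Jet) : Derivation ℝ Jet Jet :=
  MvPolynomial.mkDerivation ℝ fun m => Ds^[m] a

theorem evol_kd (a : Jet) (m : ℕ) : evol a (kd m) = Ds^[m] a := MvPolynomial.mkDerivation_X _ _ _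

theorem evol_kd_zero (a : Jet) : evol a (kd 0) = a := evol_kd a 0

theorem evol_commutes (a p : Jet) : evol a (Ds p) = Ds (evol a p) := by
  have h : ⁅evol a, Ds⁆ = 0 := by
    refine MvPolynomial.derivation_ext fun i => ?_
    rw [Derivation.commutator_apply]
    change evol a (Ds (kd i)) - Ds (evol a (kd i)) = 0
    rw [Ds_kd, evol_kd, evol_kd, Function.iterate_succ_apply', sub_self]
  have h' := congrArg (fun d => d p) h
  simp only [Derivation.commutator_apply, Derivation.coe_zero, Pi.zero_apply] at h'
  exact sub_eq_zero.mp h'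

theorem eq_evol (d : Derivation ℝ Jet Jet) (h : ∀ p, d (Ds p) = Ds (d p)) :
    d = evol (d (kd 0)) := by
  refine MvPolynomial.derivation_ext fun i => ?_
  change d (kd i) = evol _ (kd i)
  rw [evol_kd]
  induction i with
  | zero => rfl
  | succ i ih => rw [← Ds_kd, h, ih, Function.iterate_succ_apply']

/-- The Lie algebra `der*(𝒫)` of derivation vector fields `∂_a`, `a ∈ 𝒫`. -/
def derStar : LieSubalgebra ℝ (Derivation ℝ Jet Jet) where
  carrier := {d | ∃ a, d = evol a}
  zero_mem' := ⟨_, eq_evol 0 fun p => by simp⟩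
  add_mem' := by
    rintro _ _ ⟨a, rfl⟩ ⟨b, rfl⟩
    exact ⟨_, eq_evol _ fun p => by simp [evol_commutes]⟩
  smul_mem' := by
    rintro c _ ⟨a, rfl⟩
    exact ⟨_, eq_evol _ fun p => by simp [evol_commutes]⟩
  lie_mem' := by
    rintro _ _ ⟨a, rfl⟩ ⟨b, rfl⟩
    exact ⟨_, eq_evol _ fun p => by simp [Derivation.commutator_apply, evol_commutes]⟩

theorem evol_add (a b : Jet) : evol (a + b) = evol a + evol b := by
  refine MvPolynomial.derivation_ext fun i => ?_
  change evol _ (kd i) = evol a (kd i) + evol b (kd i)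
  rw [evol_kd, evol_kd, evol_kd, iterate_map_add]

theorem evol_smul (c : ℝ) (a : Jet) : evol (c • a) = c • evol a := by
  refine MvPolynomial.derivation_ext fun i => ?_
  change evol _ (kd i) = c • evol a (kd i)
  rw [evol_kd, evol_kd]
  induction i with
  | zero => rfl
  | succ i ih => rw [Function.iterate_succ_apply', Function.iterate_succ_apply', ih, Derivation.map_smul]

/-- `a ↦ ∂_a`, as a linear map into `der*(𝒫)`. -/
def evolStar : Jet →ₗ[ℝ] derStar where
  toFun a := ⟨evol a, a, rfl⟩
  map_add' a b := Subtype.ext (evol_add a b)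
  map_smul' c a := Subtype.ext (evol_smul c a)

/-- `∂_a ↦ a = ∂_a k`. -/
def charStar : derStar →ₗ[ℝ] Jet where
  toFun d := d.1 (kd 0)
  map_add' _ _ := rfl
  map_smul' _ _ := rfl

/-- The characteristic of `ℛ`: the partial operator `a ↦ D_s² a + k² a + k' D_s⁻¹ (k a)` on `𝒫`,
defined when `k a` is a total derivative. -/
def mkdvChar : Jet →ₗ.[ℝ] Jet :=
  ((Ds.toLinearMap ∘ₗ Ds.toLinearMap + LinearMap.mulLeft ℝ (kd 0 ^ 2)).toPMap ⊤) +
    (LinearMap.mulLeft ℝ (kd 1)).compPMap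
      (compP DsInv ((LinearMap.mulLeft ℝ (kd 0)).toPMap ⊤))

/-- The mKdV recursion operator `ℛ ∂_a = ∂_{(D_s² + k² + k' D_s⁻¹ k) a}` on `der*(𝒫)`. -/
def mkdvR : derStar →ₗ.[ℝ] derStar :=
  evolStar.compPMap (compP mkdvChar (charStar.toPMap ⊤))

/-! ### Local variation vector fields along a curve -/

/-- A variation vector field `V = f T + g N` along a plane curve with local components
`f, g ∈ 𝒫`, encoded as the pair `(f, g)`. -/
def FrameField : Type := Jet × Jet

namespace FrameField

instance : AddCommGroup FrameField := inferInstanceAs (AddCommGroup (Jet × Jet))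

instance : Module ℝ FrameField := inferInstanceAs (Module ℝ (Jet × Jet))

/-- The tangential component `f`. -/
def tan : FrameField →ₗ[ℝ] Jet := LinearMap.fst ℝ Jet Jet

/-- The normal component `g`. -/
def nor : FrameField →ₗ[ℝ] Jet := LinearMap.snd ℝ Jet Jet

/-- The field `f T + g N`. -/
def mk (f g : Jet) : FrameField := (f, g)

@[simp] theorem tan_mk (f g : Jet) : tan (mk f g) = f := rfl

@[simp] theorem nor_mk (f g : Jet) : nor (mk f g) = g := rfl

theorem ext' {V W : FrameField} (h : tan V = tan W) (h' : nor V = nor W) : V = W :=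
  Prod.ext h h'

/-- `ρ_V = ⟨∇_T V, T⟩ = f' - k g`. -/
def rho (V : FrameField) : Jet := Ds (tan V) - kd 0 * nor V

/-- `φ_V = ⟨∇_T V, N⟩ = g' + k f`. -/
def phi (V : FrameField) : Jet := Ds (nor V) + kd 0 * tan V

/-- The values `V(k⁽ᵐ⁾)`: `V(k) = φ_V' - k ρ_V` and `V(k⁽ᵐ⁺¹⁾) = V(k⁽ᵐ⁾)' - ρ_V k⁽ᵐ⁺¹⁾`. -/
def actVal (V : FrameField) : ℕ → Jet
  | 0 => Ds (phi V) - kd 0 * rho V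
  | m + 1 => Ds (actVal V m) - rho V * kd (m + 1)

/-- The derivation of `𝒫` induced by a variation vector field, determined by
`V(k) = φ_V' - k ρ_V` and `V(p') = V(p)' - ρ_V p'` (that is, `[V, T] = -ρ_V T`). -/
def act (V : FrameField) : Derivation ℝ Jet Jet := MvPolynomial.mkDerivation ℝ (actVal V)

/-- The derivation `D_V` on variation vector fields, with `D_V T = φ_V N`, `D_V N = -φ_V T`. -/
def cov (V W : FrameField) : FrameField :=
  mk (act V (tan W) - nor W * phi V) (act V (nor W) + tan W * phi V)

instance : Bracket FrameField FrameField := ⟨fun V W => cov V W - cov W V⟩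

theorem act_kd (V : FrameField) (m : ℕ) : act V (kd m) = actVal V m :=
  MvPolynomial.mkDerivation_X _ _ _

theorem act_k (V : FrameField) : act V (kd 0) = Ds (phi V) - kd 0 * rho V := act_kd V 0

theorem act_Ds (V : FrameField) (p : Jet) : act V (Ds p) = Ds (act V p) - rho V * Ds p := by
  have h : ⁅act V, Ds⁆ = (-rho V) • Ds := by
    refine MvPolynomial.derivation_ext fun i => ?_
    rw [Derivation.commutator_apply]
    change act V (Ds (kd i)) - Ds (act V (kd i)) = (-rho V) * Ds (kd i)
    rw [Ds_kd, act_kd, act_kd, actVal]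
    ring
  have h' := congrArg (fun d => d p) h
  simp only [Derivation.commutator_apply, Derivation.coe_smul, Pi.smul_apply, smul_eq_mul] at h'
  linear_combination h'

theorem tan_lie (V W : FrameField) :
    tan ⁅V, W⁆ = act V (tan W) - nor W * phi V - (act W (tan V) - nor V * phi W) := rfl

theorem nor_lie (V W : FrameField) :
    nor ⁅V, W⁆ = act V (nor W) + tan W * phi V - (act W (nor V) + tan V * phi W) := rfl

theorem rho_lie (V W : FrameField) : rho ⁅V, W⁆ = act V (rho W) - act W (rho V) := by
  have e : ∀ U : FrameField, rho U = Ds (tan U) - kd 0 * nor U := fun _ => rfl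
  rw [e ⁅V, W⁆, tan_lie, nor_lie]
  have h1 : act V (rho W) = act V (Ds (tan W)) - act V (kd 0 * nor W) := by rw [e W, map_sub]
  have h2 : act W (rho V) = act W (Ds (tan V)) - act W (kd 0 * nor V) := by rw [e V, map_sub]
  rw [h1, h2]
  simp only [map_sub, Derivation.leibniz, act_Ds, act_k, smul_eq_mul]
  have e' : ∀ U : FrameField, Ds (tan U) = rho U + kd 0 * nor U := fun U => by rw [rho]; ring
  have e'' : ∀ U : FrameField, Ds (nor U) = phi U - kd 0 * tan U := fun U => by rw [phi]; ring
  rw [e' V, e' W, e'' V, e'' W]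
  ring

theorem phi_lie (V W : FrameField) : phi ⁅V, W⁆ = act V (phi W) - act W (phi V) := by
  have e : ∀ U : FrameField, phi U = Ds (nor U) + kd 0 * tan U := fun _ => rfl
  rw [e ⁅V, W⁆, tan_lie, nor_lie]
  have h1 : act V (phi W) = act V (Ds (nor W)) + act V (kd 0 * tan W) := by rw [e W, map_add]
  have h2 : act W (phi V) = act W (Ds (nor V)) + act W (kd 0 * tan V) := by rw [e V, map_add]
  rw [h1, h2]
  simp only [map_sub, map_add, Derivation.leibniz, act_Ds, act_k, smul_eq_mul]
  have e' : ∀ U : FrameField, Ds (tan U) = rho U + kd 0 * nor U := fun U => by rw [rho]; ring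
  have e'' : ∀ U : FrameField, Ds (nor U) = phi U - kd 0 * tan U := fun U => by rw [phi]; ring
  rw [e' V, e' W, e'' V, e'' W]
  ring

theorem act_lie (V W : FrameField) : act ⁅V, W⁆ = ⁅act V, act W⁆ := by
  refine MvPolynomial.derivation_ext fun i => ?_
  change act ⁅V, W⁆ (kd i) = _
  rw [Derivation.commutator_apply]
  change _ = act V (act W (kd i)) - act W (act V (kd i))
  induction i with
  | zero =>
    rw [act_k, phi_lie, rho_lie, act_k, act_k]
    simp only [map_sub, Derivation.leibniz, act_Ds, act_k, smul_eq_mul]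
    ring
  | succ i ih =>
    rw [← Ds_kd, act_Ds, ih, rho_lie]
    simp only [act_Ds, map_sub, Derivation.leibniz, smul_eq_mul]
    ring

theorem rho_add (V W : FrameField) : rho (V + W) = rho V + rho W := by
  simp only [rho, map_add]; ring

theorem phi_add (V W : FrameField) : phi (V + W) = phi V + phi W := by
  simp only [phi, map_add]; ring

theorem rho_smul (c : ℝ) (V : FrameField) : rho (c • V) = c • rho V := by
  simp only [rho, map_smul, Derivation.map_smul, mul_smul_comm, smul_sub]

theorem phi_smul (c : ℝ) (V : FrameField) : phi (c • V) = c • phi V := by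
  simp only [phi, map_smul, Derivation.map_smul, mul_smul_comm, smul_add]

theorem act_add (V W : FrameField) : act (V + W) = act V + act W := by
  refine MvPolynomial.derivation_ext fun i => ?_
  change act (V + W) (kd i) = act V (kd i) + act W (kd i)
  induction i with
  | zero => rw [act_k, act_k, act_k, phi_add, rho_add, map_add]; ring
  | succ i ih => rw [← Ds_kd, act_Ds, act_Ds, act_Ds, ih, rho_add, map_add]; ring

theorem act_smul (c : ℝ) (V : FrameField) : act (c • V) = c • act V := by
  refine MvPolynomial.derivation_ext fun i => ?_
  change act (c • V) (kd i) = c • act V (kd i)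
  induction i with
  | zero =>
    rw [act_k, act_k, phi_smul, rho_smul, Derivation.map_smul, mul_smul_comm, smul_sub]
  | succ i ih =>
    rw [← Ds_kd, act_Ds, act_Ds, ih, rho_smul, Derivation.map_smul, smul_mul_assoc, smul_sub]

/-- The Lie algebra of local variation vector fields, `[V, W] = D_V W - D_W V`. -/
instance : LieRing FrameField where
  add_lie V V' W := by
    apply ext' <;>
    simp only [tan_lie, nor_lie, map_add, act_add, phi_add, Derivation.coe_add, Pi.add_apply] <;>
    ring
  lie_add V W W' := by
    apply ext' <;>
    simp only [tan_lie, nor_lie, map_add, act_add, phi_add, Derivation.coe_add, Pi.add_apply] <;>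
    ring
  lie_self V := by
    apply ext' <;> simp only [tan_lie, nor_lie, map_zero, sub_self]
  leibniz_lie V W U := by
    apply ext' <;>
    simp only [tan_lie, nor_lie, map_add, map_sub, phi_lie, act_lie, Derivation.commutator_apply,
      Derivation.leibniz, smul_eq_mul] <;>
    ring

instance : LieAlgebra ℝ FrameField where
  lie_smul c V W := by
    apply ext' <;>
    simp only [tan_lie, nor_lie, map_smul, act_smul, phi_smul, Derivation.map_smul,
      Derivation.coe_smul, Pi.smul_apply, smul_mul_assoc, mul_smul_comm, smul_sub, smul_add]

end FrameField

open FrameField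

theorem phi_mem_jetZero {V : FrameField} (h : tan V ∈ jetZero) : phi V ∈ jetZero := by
  refine jetZero.add_mem (Ds_mem_jetZero _) ?_
  rw [mem_jetZero] at *
  simp [h]

/-- The local arc-length preserving fields along a curve, `f T + g N` with `f ∈ 𝒫₀` and
`f' = k g` (that is, `f = D_s⁻¹(k g)`), as a Lie subalgebra of all local variation fields. -/
def arcFields : LieSubalgebra ℝ FrameField where
  carrier := {V | tan V ∈ jetZero ∧ Ds (tan V) = kd 0 * nor V}
  zero_mem' := by simp
  add_mem' := by
    rintro V W ⟨hV, hV'⟩ ⟨hW, hW'⟩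
    refine ⟨?_, ?_⟩
    · rw [map_add]; exact jetZero.add_mem hV hW
    · rw [map_add, map_add, map_add, hV', hW', mul_add]
  smul_mem' := by
    rintro c V ⟨hV, hV'⟩
    refine ⟨?_, ?_⟩
    · rw [map_smul]; exact jetZero.smul_mem c hV
    · rw [LinearMap.map_smul, LinearMap.map_smul, Derivation.map_smul, hV', mul_smul_comm]
  lie_mem' := by
    rintro V W ⟨hV, hV'⟩ ⟨hW, hW'⟩
    have rV : rho V = 0 := sub_eq_zero.mpr hV'
    have rW : rho W = 0 := sub_eq_zero.mpr hW'
    have aux : ∀ U : FrameField, tan U ∈ jetZero → rho U = 0 → ∀ p, act U p ∈ jetZero := by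
      intro U _ rU p
      refine derivation_mem_jetZero _ (fun m => ?_) p
      induction m with
      | zero => rw [act_k, rU, mul_zero, sub_zero]; exact Ds_mem_jetZero _
      | succ m _ => rw [← Ds_kd, act_Ds, rU, zero_mul, sub_zero]; exact Ds_mem_jetZero _
    refine ⟨?_, ?_⟩
    · have pV := phi_mem_jetZero hV
      have pW := phi_mem_jetZero hW
      have aV := aux V hV rV (tan W)
      have aW := aux W hW rW (tan V)
      rw [mem_jetZero] at *
      simp [tan_lie, pV, pW, aV, aW]
    · have := rho_lie V W
      rw [rV, rW, map_zero, map_zero, sub_zero] at this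
      exact sub_eq_zero.mp this

/-- `V ↦ V(k) = φ_V'` on the arc-length preserving fields. -/
def curvVariation : arcFields →ₗ[ℝ] Jet where
  toFun V := act V.1 (kd 0)
  map_add' V W := by
    change act (V.1 + W.1) _ = _
    rw [act_add]; rfl
  map_smul' c V := by
    change act (c • V.1) _ = _
    rw [act_smul]; rfl

/-- The map `Φ_γ(V) = ∂_{V(k)}`. -/
def Phi : arcFields →ₗ[ℝ] derStar := evolStar ∘ₗ curvVariation

theorem sq_add_sq_eq_zero {p q : Jet} (h : p ^ 2 + q ^ 2 = 0) : p = 0 := by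
  refine MvPolynomial.funext fun x => ?_
  have := congrArg (MvPolynomial.eval x) h
  simp only [map_add, map_pow, map_zero] at this
  rw [map_zero]
  nlinarith [sq_nonneg (MvPolynomial.eval x p), sq_nonneg (MvPolynomial.eval x q),
    pow_eq_zero_iff (n := 2) (a := MvPolynomial.eval x p) (by norm_num)]

theorem Phi_injective : Function.Injective Phi := by
  rw [← LinearMap.ker_eq_bot, LinearMap.ker_eq_bot']
  rintro ⟨V, hV, hV'⟩ h
  have h0 : act V (kd 0) = 0 := by
    have := congrArg (fun d => d.1 (kd 0)) h
    simpa using (evol_kd_zero (act V (kd 0))).symm.trans this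
  have rV : rho V = 0 := sub_eq_zero.mpr hV'
  rw [act_k, rV, mul_zero, sub_zero] at h0
  have hphi : phi V = 0 := eq_zero_of_Ds h0 (phi_mem_jetZero hV)
  have hg : Ds (nor V) = -(kd 0 * tan V) := eq_neg_of_add_eq_zero_left hphi
  have hgz : nor V ∈ jetZero := by
    have h1 := congrArg (fun p => MvPolynomial.constantCoeff (MvPolynomial.pderiv 0 p)) hV'
    have h2 := mem_jetZero.mp (Ds_mem_jetZero (MvPolynomial.pderiv 0 (tan V)))
    simp only [pderiv_zero_Ds, h2, MvPolynomial.pderiv_mul, MvPolynomial.pderiv_X_self, map_add,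
      map_mul, MvPolynomial.constantCoeff_X, zero_mul, add_zero, one_mul] at h1
    exact mem_jetZero.mpr h1.symm
  have hsq : tan V ^ 2 + nor V ^ 2 = 0 := by
    refine eq_zero_of_Ds ?_ ?_
    · simp only [map_add, Derivation.leibniz_pow, hV', hg, smul_eq_mul, nsmul_eq_mul]
      ring
    · rw [mem_jetZero] at *
      simp [hV, hgz]
  have hf : tan V = 0 := sq_add_sq_eq_zero hsq
  have hn : nor V = 0 := sq_add_sq_eq_zero (add_comm _ _ |>.trans hsq)
  exact Subtype.ext (FrameField.ext' hf hn)

/-- The local operator `Φ_γ⁻¹ ℛ Φ_γ`, with its natural domain. -/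
def conjR : arcFields →ₗ.[ℝ] arcFields :=
  compP (invPMap Phi Phi_injective) (compP mkdvR (Phi.toPMap ⊤))

/-- The field `½ k² T + k' N`. -/
def filament : arcFields :=
  ⟨FrameField.mk ((1 / 2 : ℝ) • kd 0 ^ 2) (kd 1), by
    constructor
    · rw [mem_jetZero]; simp [MvPolynomial.smul_eq_C_mul]
    · rw [tan_mk, nor_mk, Derivation.map_smul, sq, Derivation.leibniz, Ds_kd, smul_eq_mul,
        ← two_smul ℝ, smul_smul]
      norm_num⟩

/-! ### Plane curves and vector fields on the space of curves -/

/-- The space `Λ₀` of smooth arc-length parametrized plane curves `γ : I → ℝ²`. A map on `I` is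
represented by its extension by zero, so that equal curves are equal terms. -/
structure PlaneCurve (I : Set ℝ) where
  /-- The parametrization. -/
  toFun : ℝ → EuclideanSpace ℝ (Fin 2)
  smooth : ContDiffOn ℝ ∞ toFun I
  unit_speed : ∀ s ∈ I, ‖derivWithin toFun I s‖ = 1
  zero_off : ∀ s, s ∉ I → toFun s = 0

namespace PlaneCurve

variable {I : Set ℝ}

/-- The unit tangent `T = γ'`. -/
def tangent (γ : PlaneCurve I) (s : ℝ) : EuclideanSpace ℝ (Fin 2) := derivWithin γ.toFun I s

/-- The unit normal `N`, the rotation of `T` by a right angle. -/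
def normal (γ : PlaneCurve I) (s : ℝ) : EuclideanSpace ℝ (Fin 2) :=
  !₂[-(γ.tangent s 1), γ.tangent s 0]

/-- The (signed) curvature `k`, given by `T' = k N`. -/
def curvature (γ : PlaneCurve I) (s : ℝ) : ℝ :=
  inner ℝ (derivWithin γ.tangent I s) (γ.normal s)

/-- The value at the parameter `s` of a polynomial in the curvature of `γ` and its derivatives. -/
def evalJet (γ : PlaneCurve I) (s : ℝ) : Jet →ₐ[ℝ] ℝ :=
  MvPolynomial.aeval fun m => iteratedDerivWithin m γ.curvature I s

end PlaneCurve

/-- The vector fields `V = f T + g N` on `Λ₀` with `f_γ, g_γ ∈ 𝒫` for every curve `γ`. -/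
def VarField (I : Set ℝ) : Type := PlaneCurve I → FrameField

namespace VarField

variable {I : Set ℝ}

instance : AddCommGroup (VarField I) := inferInstanceAs (AddCommGroup (PlaneCurve I → FrameField))

instance : Module ℝ (VarField I) := inferInstanceAs (Module ℝ (PlaneCurve I → FrameField))

/-- The Lie algebra structure `[V, W](γ) = [V(γ), W(γ)]`. -/
instance : LieRing (VarField I) where
  bracket V W := fun γ => ⁅V γ, W γ⁆
  add_lie V W U := funext fun γ => add_lie (V γ) (W γ) (U γ)
  lie_add V W U := funext fun γ => lie_add (V γ) (W γ) (U γ)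
  lie_self V := funext fun γ => lie_self (V γ)
  leibniz_lie V W U := funext fun γ => leibniz_lie (V γ) (W γ) (U γ)

instance : LieAlgebra ℝ (VarField I) where
  lie_smul c V W := funext fun γ => lie_smul c (V γ) (W γ)

/-- The vector along the curve `γ` at the parameter `s` which the field `V` stands for. -/
def vec (V : VarField I) (γ : PlaneCurve I) (s : ℝ) : EuclideanSpace ℝ (Fin 2) :=
  γ.evalJet s (tan (V γ)) • γ.tangent s + γ.evalJet s (nor (V γ)) • γ.normal s

end VarField

/-- The Lie algebra `𝔛_𝒜(Λ₀)` of arc-length preserving vector fields `f T + g N` on `Λ₀` with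
components in `𝒜`: for every curve `γ`, `f_γ = D_s⁻¹(k g_γ)`. -/
def ArcField (I : Set ℝ) : LieSubalgebra ℝ (VarField I) where
  carrier := {V | ∀ γ, V γ ∈ arcFields}
  zero_mem' := fun _ => arcFields.zero_mem
  add_mem' := fun hV hW γ => arcFields.add_mem (hV γ) (hW γ)
  smul_mem' := fun c _ hV γ => arcFields.smul_mem c (hV γ)
  lie_mem' := fun hV hW γ => arcFields.lie_mem (hV γ) (hW γ)

/-- The value `V_γ` of a field `V ∈ 𝔛_𝒜(Λ₀)` at the curve `γ`. -/
def atCurve {I : Set ℝ} (γ : PlaneCurve I) : ArcField I →ₗ[ℝ] arcFields where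
  toFun V := ⟨V.1 γ, V.2 γ⟩
  map_add' _ _ := rfl
  map_smul' _ _ := rfl

/-- The operator `ℛ̄` on `𝔛_𝒜(Λ₀)`, `(ℛ̄ V)(γ) = (Φ_γ⁻¹ ℛ Φ_γ)(V_γ)`, defined when
`Φ_γ⁻¹ ℛ Φ_γ` is defined on `V_γ` for every curve `γ`. -/
def barR (I : Set ℝ) : ArcField I →ₗ.[ℝ] ArcField I where
  domain :=
    { carrier := {V | ∀ γ, atCurve γ V ∈ conjR.domain}
      zero_mem' := fun γ => by rw [map_zero]; exact conjR.domain.zero_mem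
      add_mem' := fun hV hW γ => by rw [map_add]; exact conjR.domain.add_mem (hV γ) (hW γ)
      smul_mem' := fun c _ hV γ => by rw [map_smul]; exact conjR.domain.smul_mem c (hV γ) }
  toFun :=
    { toFun := fun V => ⟨fun γ => (conjR ⟨atCurve γ V.1, V.2 γ⟩).1,
        fun γ => (conjR ⟨atCurve γ V.1, V.2 γ⟩).2⟩
      map_add' := fun V W => Subtype.ext (funext fun γ => congrArg Subtype.val
        (LinearPMap.map_add conjR ⟨atCurve γ V.1, V.2 γ⟩ ⟨atCurve γ W.1, W.2 γ⟩))
      map_smul' := fun c V => Subtype.ext (funext fun γ => congrArg Subtype.val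
        (LinearPMap.map_smul conjR c ⟨atCurve γ V.1, V.2 γ⟩)) }

/-- The planar filament vector field `V_{S₀} = ½ k² T + k' N` on `Λ₀`. -/
def planarFilament (I : Set ℝ) : ArcField I := ⟨fun _ => filament.1, fun _ => filament.2⟩

end PlanarFilament

end

noncomputable section

namespace PlanarFilament

open FrameField

/-! ### The formal integral and the local operator -/

/-! The conjugated operator has a simple form: it sends `V` to the arc-length preserving field whose
normal component is `V(k)` (`conjR_eq`, `nor_conjR`). Indeed, if `W = fT + aN` with `f' = ka`, then
`W(k) = (a' + kf)' = a'' + k²a + k'f`, which is the mKdV operator applied to `a`. The inverse of `Φ`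
therefore imposes no further condition, and the domain is cut out by integrability of `k V(k)` alone
(`mem_conjR`). Since a field is determined by its normal component, each operator identity becomes
one polynomial identity in normal components, checked separately at each curve.

Vanishing torsion (`nijenhuis_local`) and invariance under the filament flow (`filament_local`) are
such identities. Heredity follows formally from vanishing torsion, and it propagates `L_V R = 0`
from `V` to `RV`, hence along the hierarchy. Commutativity then comes from `R[V_n, V_m] = [V_n,
V_{m+1}]`.

What remains is that the hierarchy never leaves the domain. Here the normal components are `h_n'`
with `h_{n+1} = (D_s + k D_s⁻¹ k) h_n'`, and the operator in brackets is formally skew. A Lenard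
exchange argument (`potential_exchange`) then shows that `k h_n'` is a total derivative. Linear
independence is read off from the linear part `k⁽²ⁿ⁾` of `h_n`. -/

theorem exists_mem_jetZero_Ds_eq {p q : Jet} (h : Ds q = p) : ∃ r ∈ jetZero, Ds r = p := by
  refine ⟨q - MvPolynomial.C (MvPolynomial.constantCoeff q), ?_, ?_⟩
  · rw [mem_jetZero]; simp
  · rw [map_sub, MvPolynomial.derivation_C, sub_zero, h]

theorem eq_of_Ds_eq {p q : Jet} (hp : p ∈ jetZero) (hq : q ∈ jetZero) (h : Ds p = Ds q) :
    p = q :=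
  sub_eq_zero.mp (eq_zero_of_Ds (by rw [map_sub, h, sub_self]) (jetZero.sub_mem hp hq))

/-- A primitive without constant term certifies membership in the domain and gives the value at
once; the existential form carries both. -/
theorem DsInv_eq {p q : Jet} (hq : q ∈ jetZero) (h : Ds q = p) :
    ∃ hp : p ∈ DsInv.domain, DsInv ⟨p, hp⟩ = q := by
  subst h
  refine ⟨⟨⟨q, hq⟩, rfl⟩, ?_⟩
  change ((LinearEquiv.ofInjective _ Ds_injective).symm ⟨Ds q, _⟩ : Jet) = q
  have : (LinearEquiv.ofInjective _ Ds_injective).symm ⟨Ds q, ⟨⟨q, hq⟩, rfl⟩⟩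
      = (⟨q, hq⟩ : jetZero) := by
    rw [LinearEquiv.symm_apply_eq]; rfl
  rw [this]

theorem mkdvChar_eq {a q : Jet} (hq : q ∈ jetZero) (h : Ds q = kd 0 * a) :
    ∃ ha : a ∈ mkdvChar.domain,
      mkdvChar ⟨a, ha⟩ = Ds (Ds a) + kd 0 ^ 2 * a + kd 1 * q := by
  obtain ⟨h1, h2⟩ := DsInv_eq hq h
  refine ⟨⟨trivial, ⟨trivial, h1⟩⟩, ?_⟩
  change Ds (Ds a) + kd 0 ^ 2 * a + kd 1 * DsInv ⟨kd 0 * a, h1⟩ = _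
  rw [h2]

theorem exists_of_mem_mkdvChar {a : Jet} (ha : a ∈ mkdvChar.domain) :
    ∃ q ∈ jetZero, Ds q = kd 0 * a := by
  obtain ⟨_, _, ⟨q, hq⟩, h⟩ := ha
  exact ⟨q, hq, h⟩

theorem rho_eq_zero (V : arcFields) : rho V.1 = 0 := sub_eq_zero.mpr V.2.2

theorem act_Ds_comm (V : arcFields) (p : Jet) : act V.1 (Ds p) = Ds (act V.1 p) := by
  rw [act_Ds, rho_eq_zero, zero_mul, sub_zero]

theorem curvVariation_apply (V : arcFields) : curvVariation V = act V.1 (kd 0) := rfl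

theorem curvVariation_eq (V : arcFields) : curvVariation V = Ds (phi V.1) := by
  rw [curvVariation_apply, act_k, rho_eq_zero, mul_zero, sub_zero]

theorem act_mem_jetZero (V : arcFields) (p : Jet) : act V.1 p ∈ jetZero := by
  refine derivation_mem_jetZero _ (fun m => ?_) p
  induction m with
  | zero => rw [← curvVariation_apply, curvVariation_eq]; exact Ds_mem_jetZero _
  | succ m _ => rw [← Ds_kd, act_Ds_comm]; exact Ds_mem_jetZero _

/-- The tangential component is the normalized primitive of `k` times the normal one. -/
theorem arcFields_ext {V W : arcFields} (h : nor V.1 = nor W.1) : V = W := by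
  refine Subtype.ext (ext' (eq_of_Ds_eq V.2.1 W.2.1 ?_) h)
  rw [V.2.2, W.2.2, h]

theorem Phi_eq_iff {V : arcFields} {a : Jet} : Phi V = evolStar a ↔ curvVariation V = a := by
  refine ⟨fun h => ?_, fun h => congrArg evolStar h⟩
  have := congrArg charStar h
  exact (evol_kd_zero _).symm.trans (this.trans (evol_kd_zero _))

theorem charStar_Phi (V : arcFields) : charStar (Phi V) = curvVariation V := evol_kd_zero _

theorem invPMap_eq {E F : Type*} [AddCommGroup E] [Module ℝ E] [AddCommGroup F] [Module ℝ F]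
    (f : E →ₗ[ℝ] F) (hf : Function.Injective f) {x : E} {y : F} (h : f x = y) :
    ∃ hy : y ∈ (invPMap f hf).domain, invPMap f hf ⟨y, hy⟩ = x := by
  subst h
  refine ⟨⟨x, rfl⟩, ?_⟩
  change (LinearEquiv.ofInjective f hf).symm ⟨f x, _⟩ = x
  rw [LinearEquiv.symm_apply_eq]; rfl

/-- `Φ⁻¹ ℛ Φ` maps `V` to `W` as soon as `W` has the normal component `V(k)`. -/
theorem conjR_eq {V W : arcFields} (h : nor W.1 = curvVariation V) :
    ∃ hV : V ∈ conjR.domain, conjR ⟨V, hV⟩ = W := by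
  have hq : Ds (tan W.1) = kd 0 * charStar (Phi V) := by rw [charStar_Phi, W.2.2, h]
  obtain ⟨h1, h2⟩ := mkdvChar_eq W.2.1 hq
  -- `W` is itself the preimage under `Φ`: with `a = V(k)` and `f' = ka`, differentiating `a' + kf`
  -- gives `a'' + k²a + k'f`.
  have hval : Phi W = evolStar (mkdvChar ⟨charStar (Phi V), h1⟩) := by
    rw [Phi_eq_iff, h2, curvVariation_eq, phi, h, map_add, Derivation.leibniz, Ds_kd,
      W.2.2, h, charStar_Phi]
    simp only [smul_eq_mul]
    ring
  obtain ⟨h3, h4⟩ := invPMap_eq Phi Phi_injective hval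
  exact ⟨⟨⟨trivial, ⟨trivial, h1⟩⟩, h3⟩, h4⟩

/-- The field with normal component `a` and tangential component `D_s⁻¹(k a)`. -/
theorem exists_arcField {a p : Jet} (h : Ds p = kd 0 * a) : ∃ W : arcFields, nor W.1 = a := by
  obtain ⟨q, hq, hq'⟩ := exists_mem_jetZero_Ds_eq h
  exact ⟨⟨mk q a, hq, hq'⟩, rfl⟩

theorem exists_of_mem_conjR {V : arcFields} (h : V ∈ conjR.domain) :
    ∃ p, Ds p = kd 0 * curvVariation V := by
  obtain ⟨⟨_, _, h⟩, _⟩ := h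
  obtain ⟨q, _, hq⟩ := exists_of_mem_mkdvChar h
  exact ⟨q, by rw [hq, ← charStar_Phi]; rfl⟩

theorem mem_conjR {V : arcFields} :
    V ∈ conjR.domain ↔ ∃ p, Ds p = kd 0 * curvVariation V := by
  refine ⟨exists_of_mem_conjR, fun ⟨p, hp⟩ => ?_⟩
  obtain ⟨W, hW⟩ := exists_arcField hp
  exact (conjR_eq hW).1

theorem nor_conjR {V : arcFields} (h : V ∈ conjR.domain) :
    nor (conjR ⟨V, h⟩).1 = curvVariation V := by
  obtain ⟨p, hp⟩ := exists_of_mem_conjR h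
  obtain ⟨W, hW⟩ := exists_arcField hp
  obtain ⟨_, h2⟩ := conjR_eq hW
  rw [h2, hW]

/-! ### The bracket and the local operator -/

theorem curvVariation_lie (V W : arcFields) :
    curvVariation ⁅V, W⁆ = act V.1 (curvVariation W) - act W.1 (curvVariation V) := by
  change act ⁅V.1, W.1⁆ (kd 0) = _
  rw [act_lie, Derivation.commutator_apply]; rfl

theorem nor_lie_arc (V W : arcFields) :
    nor (⁅V, W⁆ : arcFields).1 = act V.1 (nor W.1) + tan W.1 * phi V.1
      - (act W.1 (nor V.1) + tan V.1 * phi W.1) := rfl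

/-- This puts `[V, W]` in the domain. Fields commute with `D_s`, so the derivative of `V(f_{W'}) -
W(f_{V'})` is `V(k W(k)) - W(k V(k))`; the cross terms `V(k) W(k)` cancel, leaving `k [V, W](k)`. -/
theorem exists_lie_image {V V' W W' : arcFields} (hV : nor V'.1 = curvVariation V)
    (hW : nor W'.1 = curvVariation W) :
    ∃ Z : arcFields, nor Z.1 = curvVariation ⁅V, W⁆ ∧
      tan Z.1 = act V.1 (tan W'.1) - act W.1 (tan V'.1) := by
  refine ⟨⟨mk (act V.1 (tan W'.1) - act W.1 (tan V'.1)) (curvVariation ⁅V, W⁆), ?_, ?_⟩, rfl, rfl⟩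
  · exact jetZero.sub_mem (act_mem_jetZero _ _) (act_mem_jetZero _ _)
  · simp only [tan_mk, nor_mk]
    rw [map_sub, ← act_Ds_comm, ← act_Ds_comm, W'.2.2, V'.2.2, hV, hW, curvVariation_lie,
      Derivation.leibniz, Derivation.leibniz, ← curvVariation_apply, ← curvVariation_apply]
    simp only [smul_eq_mul]
    ring

theorem curvVariation_of_nor {V V' : arcFields} (hV : nor V'.1 = curvVariation V) :
    curvVariation V' = Ds (Ds (curvVariation V)) + kd 0 ^ 2 * curvVariation V
      + kd 1 * tan V'.1 := by
  rw [curvVariation_eq, phi, hV, map_add, Derivation.leibniz, Ds_kd, V'.2.2, hV]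
  simp only [smul_eq_mul]
  ring

/-- Here `V'`, `W'`, `Z` are the images of `V`, `W`, `[V, W]`. The only nonlocal quantities are the
tangential components of the images, and that of `Z` is known from `exists_lie_image`. It absorbs
the terms `k' V(f_{W'}) - k' W(f_{V'})`, so the rest is an identity of polynomials. -/
theorem nijenhuis_local {V V' W W' Z : arcFields} (hV : nor V'.1 = curvVariation V)
    (hW : nor W'.1 = curvVariation W) (hZ : nor Z.1 = curvVariation ⁅V, W⁆) :
    nor (⁅V', W'⁆ : arcFields).1 = curvVariation (⁅V', W⁆ + ⁅V, W'⁆ - Z) := by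
  obtain ⟨Z', hZ', htan⟩ := exists_lie_image hV hW
  -- Identifying `Z` with the explicit field gives its tangential component without any integration.
  obtain rfl : Z = Z' := arcFields_ext (hZ.trans hZ'.symm)
  rw [map_sub, map_add, curvVariation_of_nor hZ, htan, curvVariation_lie, curvVariation_lie,
    curvVariation_lie, curvVariation_of_nor hV, curvVariation_of_nor hW, nor_lie_arc, phi, phi,
    hV, hW]
  have e : ∀ U : arcFields, act U.1 (kd 1) = Ds (curvVariation U) := fun U => by
    rw [← Ds_kd, act_Ds_comm, ← curvVariation_apply]
  simp only [map_add, map_sub, Derivation.leibniz, Derivation.leibniz_pow, act_Ds_comm, e,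
    ← curvVariation_apply, smul_eq_mul, nsmul_eq_mul]
  push_cast
  ring

theorem nor_filament : nor filament.1 = kd 1 := rfl

theorem two_mul_tan_filament : 2 * tan filament.1 = kd 0 ^ 2 := by
  change 2 * ((1 / 2 : ℝ) • kd 0 ^ 2) = kd 0 ^ 2
  rw [two_mul, ← add_smul, add_halves, one_smul]

theorem act_tan_filament (U : arcFields) :
    act U.1 (tan filament.1) = kd 0 * curvVariation U := by
  have h := congrArg (act U.1) two_mul_tan_filament
  rw [two_mul, map_add, sq, Derivation.leibniz, ← curvVariation_apply, smul_eq_mul, ← two_mul,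
    ← two_mul] at h
  exact mul_left_cancel₀ two_ne_zero h

/-- States that bracketing with the filament field commutes with the operator. The term
`filament(W(k))` occurs on both sides; what is left is the linearization of the mKdV expression
`k''' + (3/2) k² k'` in the direction `W(k)`. -/
theorem filament_local {W W' : arcFields} (hW : nor W'.1 = curvVariation W) :
    nor (⁅filament, W'⁆ : arcFields).1 = curvVariation ⁅filament, W⁆ := by
  have ht := two_mul_tan_filament
  have hd : Ds (tan filament.1) = kd 0 * kd 1 := filament.2.2
  have e : ∀ U : arcFields, act U.1 (kd 1) = Ds (curvVariation U) := fun U => by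
    rw [← Ds_kd, act_Ds_comm, ← curvVariation_apply]
  rw [curvVariation_lie, nor_lie_arc, hW, curvVariation_eq filament, phi, phi, nor_filament, hW,
    e, curvVariation_of_nor hW]
  simp only [map_add, act_Ds_comm]
  simp only [map_add, Derivation.leibniz, Derivation.leibniz_pow, e, ← curvVariation_apply,
    act_tan_filament, W'.2.2, hW, hd, smul_eq_mul, nsmul_eq_mul, Ds_kd]
  push_cast
  -- `ring` treats the tangential component of the filament as an atom; `ht`, its doubled formula,
  -- is not needed, since `hd` and `act_tan_filament` account for its derivatives.
  ring

/-! ### Recursion operators on a Lie algebra -/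

section LieAlgebra

variable {L : Type*} [LieRing L] [LieAlgebra ℝ L] {R : L →ₗ.[ℝ] L}

theorem LinearPMap_congr {E F : Type*} [AddCommGroup E] [Module ℝ E] [AddCommGroup F] [Module ℝ F]
    (f : E →ₗ.[ℝ] F) {x y : E} (h : x = y) (hx : x ∈ f.domain) (hy : y ∈ f.domain) :
    f ⟨x, hx⟩ = f ⟨y, hy⟩ := by
  subst h; rfl

theorem isRecursionOperator_iff {ξ : L} :
    IsRecursionOperator ξ R ↔ ∀ η (h : η ∈ R.domain),
      ∃ h' : ⁅ξ, η⁆ ∈ R.domain, R ⟨⁅ξ, η⁆, h'⟩ = ⁅ξ, R ⟨η, h⟩⁆ := by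
  refine ⟨fun H η h => ?_, fun H => LinearPMap.ext ?_ ?_⟩
  · have hd : η ∈ (lieDeriv ξ R).domain := by rw [show lieDeriv ξ R = _ from H]; exact h
    refine ⟨hd.2, (sub_eq_zero.mp ?_).symm⟩
    exact (LinearPMap.ext_iff.mp H).2 (x := η) (hf := hd) (hg := h)
  · ext η
    exact ⟨fun h => h.1, fun h => ⟨h, (H η h).1⟩⟩
  · intro η h _
    exact sub_eq_zero.mpr (H η h.1).2.symm

/-- The torsion identity rearranges to `[Rξ, Rη] - R[Rξ, η] = R([ξ, Rη] - R[ξ, η])`. Splitting the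
argument of `R` is legitimate because the whole sum lies in the domain, so one summand does exactly
when the other does; this also gives equality of domains. -/
theorem NijenhuisTorsionVanishes.isHereditary (H : NijenhuisTorsionVanishes R) :
    IsHereditary R := by
  intro ξ
  have key : ∀ η (h : η ∈ R.domain) (h0 : ⁅(ξ : L), η⁆ ∈ R.domain),
      ⁅R ξ, η⁆ + (⁅(ξ : L), R ⟨η, h⟩⁆ - R ⟨⁅(ξ : L), η⁆, h0⟩) ∈ R.domain := by
    intro η h h0
    obtain ⟨_, h2, _⟩ := H ξ ⟨η, h⟩
    rwa [add_sub_assoc] at h2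
  refine LinearPMap.ext ?_ ?_
  · ext η
    constructor
    · rintro ⟨h, h1⟩
      obtain ⟨h0, -⟩ := H ξ ⟨η, h⟩
      exact ⟨⟨h, h0⟩, (R.domain.add_mem_iff_right h1).mp (key η h h0)⟩
    · rintro ⟨⟨h, h0⟩, h1⟩
      exact ⟨h, (R.domain.add_mem_iff_left h1).mp (key η h h0)⟩
  · rintro η ⟨h, h1⟩ ⟨⟨_, h0⟩, h2⟩
    obtain ⟨_, h3, h4⟩ := H ξ ⟨η, h⟩
    change ⁅R ξ, R ⟨η, h⟩⁆ - R ⟨⁅R ξ, η⁆, h1⟩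
      = R ⟨⁅(ξ : L), R ⟨η, h⟩⁆ - R ⟨⁅(ξ : L), η⁆, h0⟩, h2⟩
    rw [← h4, ← LinearPMap.map_sub]
    refine LinearPMap_congr R ?_ _ _
    simp only
    abel

theorem IsHereditary.isRecursionOperator (H : IsHereditary R) {ξ : R.domain}
    (h : IsRecursionOperator (ξ : L) R) : IsRecursionOperator (R ξ) R := by
  rw [IsRecursionOperator, H ξ, show lieDeriv (ξ : L) R = _ from h]
  refine LinearPMap.ext ?_ ?_
  · ext η
    exact ⟨fun h => h.1, fun h => ⟨h, R.domain.zero_mem⟩⟩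
  · intro η _ _
    exact LinearPMap.map_zero R

/-- Since `R[V n, V m] = [V n, V (m + 1)]`, a vanishing bracket stays zero when the second index is
raised. Starting from `[V 0, V 0] = 0`, this and skew-symmetry give `[V n, V 0] = 0`, and raising
the second index again reaches every pair. -/
theorem lie_eq_zero_of_isRecursionOperator {V : ℕ → L}
    (hV : ∀ n, ∃ h : V n ∈ R.domain, R ⟨V n, h⟩ = V (n + 1))
    (h : ∀ n, IsRecursionOperator (V n) R) (n m : ℕ) : ⁅V n, V m⁆ = 0 := by
  have step : ∀ n m, ⁅V n, V m⁆ = 0 → ⁅V n, V (m + 1)⁆ = 0 := by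
    intro n m h0
    obtain ⟨h1, h2⟩ := hV m
    obtain ⟨h3, h4⟩ := isRecursionOperator_iff.mp (h n) (V m) h1
    rw [← h2, ← h4, LinearPMap_congr R h0 h3 R.domain.zero_mem]
    exact LinearPMap.map_zero R
  have zero : ∀ n, ⁅V 0, V n⁆ = 0 := by
    intro n
    induction n with
    | zero => exact lie_self _
    | succ n ih => exact step 0 n ih
  induction m with
  | zero => rw [← lie_skew, zero, neg_zero]
  | succ m ih => exact step n m ih

end LieAlgebra

/-! ### The operator on the space of curves -/

section Curves

variable {I : Set ℝ}

theorem arcField_ext {V W : ArcField I} (h : ∀ γ, atCurve γ V = atCurve γ W) : V = W :=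
  Subtype.ext (funext fun γ => congrArg Subtype.val (h γ))

theorem barR_eq {V W : ArcField I}
    (h : ∀ γ, nor (atCurve γ W).1 = curvVariation (atCurve γ V)) :
    ∃ hV : V ∈ (barR I).domain, barR I ⟨V, hV⟩ = W :=
  ⟨fun γ => (conjR_eq (h γ)).1, arcField_ext fun γ => (conjR_eq (h γ)).2⟩

theorem nor_barR (V : (barR I).domain) (γ : PlaneCurve I) :
    nor (atCurve γ (barR I V)).1 = curvVariation (atCurve γ V.1) :=
  nor_conjR (V.2 γ)

theorem atCurve_lie (γ : PlaneCurve I) (V W : ArcField I) :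
    atCurve γ ⁅V, W⁆ = ⁅atCurve γ V, atCurve γ W⁆ := rfl

theorem lie_mem_barR (V W : (barR I).domain) :
    ⁅(V : ArcField I), (W : ArcField I)⁆ ∈ (barR I).domain := fun γ => by
  obtain ⟨_, hZ, _⟩ := exists_lie_image (nor_barR V γ) (nor_barR W γ)
  exact (conjR_eq hZ).1

theorem nijenhuisTorsionVanishes_barR : NijenhuisTorsionVanishes (barR I) := fun V W => by
  refine ⟨lie_mem_barR V W, barR_eq fun γ => ?_⟩
  rw [map_sub, map_add, atCurve_lie, atCurve_lie, atCurve_lie]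
  refine nijenhuis_local (nor_barR V γ) (nor_barR W γ) ?_
  rw [nor_barR, atCurve_lie]

theorem isRecursionOperator_planarFilament :
    IsRecursionOperator (planarFilament I) (barR I) := by
  refine isRecursionOperator_iff.mpr fun W hW => barR_eq fun γ => ?_
  rw [atCurve_lie, atCurve_lie]
  exact filament_local (nor_barR ⟨W, hW⟩ γ)

end Curves

/-! ### The planar filament hierarchy -/

open Classical in
/-- The formal integral `D_s⁻¹` extended by zero to the whole of `𝒫`. -/
def integ (p : Jet) : Jet := if h : ∃ q ∈ jetZero, Ds q = p then h.choose else 0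

theorem integ_mem_jetZero (p : Jet) : integ p ∈ jetZero := by
  rw [integ]
  split_ifs with h
  · exact h.choose_spec.1
  · exact jetZero.zero_mem

theorem Ds_integ {p : Jet} (h : p ∈ LinearMap.range Ds.toLinearMap) : Ds (integ p) = p := by
  obtain ⟨q, hq⟩ := h
  have h' := exists_mem_jetZero_Ds_eq hq
  rw [integ, dif_pos h']
  exact h'.choose_spec.2

/-- The potentials `h_n` of the mKdV hierarchy: `ℛⁿ ∂_{k'} = ∂_{D_s h_n}`. -/
def potential : ℕ → Jet
  | 0 => kd 0
  | n + 1 => Ds (Ds (potential n)) + kd 0 * integ (kd 0 * Ds (potential n))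

theorem Ds_mem_range (p : Jet) : Ds p ∈ LinearMap.range Ds.toLinearMap := ⟨p, rfl⟩

/-- Formal skewness of `D_s + k D_s⁻¹ k`: modulo total derivatives, an index can be moved from one
factor to the other. The witness collects the boundary terms of the integrations by parts. -/
theorem potential_exchange {i j : ℕ}
    (hi : kd 0 * Ds (potential i) ∈ LinearMap.range Ds.toLinearMap)
    (hj : kd 0 * Ds (potential j) ∈ LinearMap.range Ds.toLinearMap) :
    potential i * Ds (potential (j + 1)) - potential (i + 1) * Ds (potential j)
      ∈ LinearMap.range Ds.toLinearMap := by
  have e : ∀ n, potential (n + 1)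
    = Ds (Ds (potential n)) + kd 0 * integ (kd 0 * Ds (potential n)) := fun _ => rfl
  refine ⟨potential i * potential (j + 1) - Ds (potential i) * Ds (potential j)
    - integ (kd 0 * Ds (potential i)) * integ (kd 0 * Ds (potential j)), ?_⟩
  change Ds _ = _
  simp only [map_sub, Derivation.leibniz, Ds_integ hi, Ds_integ hj, smul_eq_mul]
  rw [e i, e j]
  ring

/-- Modulo total derivatives, exchange moves all of `n` across, so `h_0 h_n'` agrees with `h_n
h_0'`. Their sum is `(h_0 h_n)'`, so `2 h_0 h_n'` is a total derivative, and `h_0 = k`. -/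
theorem kd_mul_Ds_potential_mem_range (n : ℕ) :
    kd 0 * Ds (potential n) ∈ LinearMap.range Ds.toLinearMap := by
  induction n using Nat.strong_induction_on with
  | _ n ih =>
    have shift : ∀ i j, i + j = n →
        potential 0 * Ds (potential n) - potential i * Ds (potential j)
          ∈ LinearMap.range Ds.toLinearMap := by
      intro i
      induction i with
      | zero => rintro j rfl; simp
      | succ i hi =>
        intro j hij
        -- With `(i + 1) + j = n` both `i` and `j` are below `n`, so the exchange uses only
        -- integrability that is already known.
        have := Submodule.add_mem _ (hi (j + 1) (by omega))
          (potential_exchange (ih i (by omega)) (ih j (by omega)))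
        rwa [sub_add_sub_cancel] at this
    have h1 := Submodule.add_mem _ (shift n 0 rfl) (Ds_mem_range (potential 0 * potential n))
    have h2 := Submodule.smul_mem _ (1 / 2 : ℝ) h1
    convert h2 using 1
    rw [Derivation.leibniz, smul_eq_mul, smul_eq_mul, add_comm, add_add_sub_cancel, ← two_smul ℝ,
      smul_smul]
    norm_num [potential]

/-- The local fields of the planar filament hierarchy. -/
def hierarchy (n : ℕ) : arcFields :=
  ⟨mk (integ (kd 0 * Ds (potential n))) (Ds (potential n)), integ_mem_jetZero _,
    Ds_integ (kd_mul_Ds_potential_mem_range n)⟩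

theorem hierarchy_zero : hierarchy 0 = filament := arcFields_ext (Ds_kd 0)

/-- The potential `h_{n+1}` is exactly `φ` of the `n`-th field. -/
theorem nor_hierarchy_succ (n : ℕ) :
    nor (hierarchy (n + 1)).1 = curvVariation (hierarchy n) := by
  rw [curvVariation_eq]; rfl

/-- Extracts the linear part of `h_n`, namely `k⁽²ⁿ⁾`: the nonlocal term is `k` times an element
without constant term, so it contributes nothing linear, and `D_s²` raises the order by two. -/
theorem constantCoeff_pderiv_potential (n m : ℕ) :
    MvPolynomial.constantCoeff (MvPolynomial.pderiv m (potential n))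
      = if m = 2 * n then 1 else 0 := by
  have hD : ∀ p, MvPolynomial.constantCoeff (Ds p) = 0 := Ds_mem_jetZero
  have hk : ∀ m p, p ∈ jetZero →
      MvPolynomial.constantCoeff (MvPolynomial.pderiv m (kd 0 * p)) = 0 := by
    intro m p hp
    rw [MvPolynomial.pderiv_mul, map_add, map_mul, map_mul, mem_jetZero.mp hp]
    simp
  induction n generalizing m with
  | zero =>
    rw [potential, MvPolynomial.pderiv_X]
    by_cases h : m = 0 <;> simp [h, eq_comm]
  | succ n ih =>
    rw [potential, map_add, map_add, hk m _ (integ_mem_jetZero _), add_zero]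
    match m with
    | 0 => rw [pderiv_zero_Ds, hD]; simp
    | 1 => rw [pderiv_Ds, pderiv_zero_Ds, map_add, hD, hD, add_zero, if_neg (by omega)]
    | m + 2 =>
      rw [pderiv_Ds, pderiv_Ds, map_add, map_add, hD, hD, add_zero, add_zero, ih]
      exact if_congr (by omega) rfl rfl

theorem linearIndependent_hierarchy : LinearIndependent ℝ hierarchy := by
  -- Coordinate `m` is the coefficient of `k⁽²ᵐ⁺¹⁾` in the normal component; the normal component
  -- `h_n'` has linear part `k⁽²ⁿ⁺¹⁾`.
  let f : arcFields →ₗ[ℝ] ℕ → ℝ := LinearMap.pi fun m =>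
    MvPolynomial.lcoeff ℝ 0 ∘ₗ (MvPolynomial.pderiv (2 * m + 1)).toLinearMap ∘ₗ nor ∘ₗ
      arcFields.toSubmodule.subtype
  have hf : f ∘ hierarchy = fun n => Pi.single n (1 : ℝ) := by
    ext n m
    change MvPolynomial.constantCoeff (MvPolynomial.pderiv (2 * m + 1) (Ds (potential n))) = _
    rw [pderiv_Ds, map_add, mem_jetZero.mp (Ds_mem_jetZero _), add_zero,
      constantCoeff_pderiv_potential, Pi.single_apply]
    exact if_congr (by omega) rfl rfl
  refine LinearIndependent.of_comp f ?_
  rw [hf]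
  exact Pi.linearIndependent_single_one ℕ ℝ

/-- A straight line segment. -/
def PlaneCurve.line {I : Set ℝ} (hI : UniqueDiffOn ℝ I) : PlaneCurve I where
  toFun := I.indicator fun s => s • EuclideanSpace.single 0 1
  smooth := by
    refine ContDiffOn.congr (f := fun s : ℝ => s • EuclideanSpace.single (0 : Fin 2) (1 : ℝ))
      (by fun_prop) fun s hs => Set.indicator_of_mem hs _
  unit_speed s hs := by
    have h : HasDerivWithinAt (fun s : ℝ => s • EuclideanSpace.single (0 : Fin 2) (1 : ℝ))
        ((1 : ℝ) • EuclideanSpace.single 0 1) I s :=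
      ((hasDerivAt_id s).smul_const _).hasDerivWithinAt
    rw [(h.congr (fun t ht => Set.indicator_of_mem ht _)
      (Set.indicator_of_mem hs _)).derivWithin (hI s hs)]
    simp
  zero_off s hs := Set.indicator_of_notMem hs _

/-- The planar filament hierarchy on the space of curves. -/
def arcHierarchy (I : Set ℝ) (n : ℕ) : ArcField I :=
  ⟨fun _ => (hierarchy n).1, fun _ => (hierarchy n).2⟩

theorem arcHierarchy_zero (I : Set ℝ) : arcHierarchy I 0 = planarFilament I :=
  arcField_ext fun _ => hierarchy_zero

theorem barR_arcHierarchy (I : Set ℝ) (n : ℕ) :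
    ∃ h : arcHierarchy I n ∈ (barR I).domain,
      barR I ⟨arcHierarchy I n, h⟩ = arcHierarchy I (n + 1) :=
  barR_eq fun _ => nor_hierarchy_succ n

theorem isRecursionOperator_arcHierarchy (I : Set ℝ) (n : ℕ) :
    IsRecursionOperator (arcHierarchy I n) (barR I) := by
  induction n with
  | zero => rw [arcHierarchy_zero]; exact isRecursionOperator_planarFilament
  | succ n ih =>
    obtain ⟨h, h'⟩ := barR_arcHierarchy I n
    rw [← h']
    exact nijenhuisTorsionVanishes_barR.isHereditary.isRecursionOperator
      (ξ := ⟨arcHierarchy I n, h⟩) ih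

/-- Ties the formal pair of polynomials to the geometric field along an actual curve. -/
theorem vec_planarFilament {I : Set ℝ} (γ : PlaneCurve I) (s : ℝ) :
    (planarFilament I : VarField I).vec γ s = (1 / 2 * γ.curvature s ^ 2) • γ.tangent s +
      derivWithin γ.curvature I s • γ.normal s := by
  change γ.evalJet s ((1 / 2 : ℝ) • kd 0 ^ 2) • _ + γ.evalJet s (kd 1) • _ = _
  rw [map_smul, map_pow]
  simp only [PlaneCurve.evalJet, MvPolynomial.aeval_X, iteratedDerivWithin_zero,
    iteratedDerivWithin_one, smul_eq_mul]

end PlanarFilament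

end

theorem mainTheorem5 (I : Set ℝ) (hI : I.OrdConnected) (hI' : (interior I).Nonempty) :
    (∀ V : PlanarFilament.ArcField I, V ∈ (PlanarFilament.barR I).domain ↔
        ∀ γ, ∃ p, PlanarFilament.Ds p =
          PlanarFilament.kd 0 *
            PlanarFilament.curvVariation (PlanarFilament.atCurve γ V)) ∧
      PlanarFilament.IsRecursionOperator (PlanarFilament.planarFilament I)
        (PlanarFilament.barR I) ∧
      PlanarFilament.IsHereditary (PlanarFilament.barR I) ∧
      PlanarFilament.NijenhuisTorsionVanishes (PlanarFilament.barR I) ∧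
      (∃ V : ℕ → PlanarFilament.ArcField I,
        V 0 = PlanarFilament.planarFilament I ∧
        (∀ n, ∃ h : V n ∈ (PlanarFilament.barR I).domain,
          PlanarFilament.barR I ⟨V n, h⟩ = V (n + 1)) ∧
        (∀ n, PlanarFilament.IsRecursionOperator (V n) (PlanarFilament.barR I)) ∧
        (∀ n m, ⁅V n, V m⁆ = 0) ∧
        LinearIndependent ℝ V) ∧
      (∀ γ : PlanarFilament.PlaneCurve I, ∀ s ∈ I,
        (PlanarFilament.planarFilament I : PlanarFilament.VarField I).vec γ s =
          (1 / 2 * γ.curvature s ^ 2) • γ.tangent s +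
            derivWithin γ.curvature I s • γ.normal s) := by
  have hd : UniqueDiffOn ℝ I := uniqueDiffOn_convex hI.convex hI'
  refine ⟨fun V => forall_congr' fun γ => PlanarFilament.mem_conjR,
    PlanarFilament.isRecursionOperator_planarFilament,
    PlanarFilament.nijenhuisTorsionVanishes_barR.isHereditary,
    PlanarFilament.nijenhuisTorsionVanishes_barR,
    ⟨PlanarFilament.arcHierarchy I, PlanarFilament.arcHierarchy_zero I,
      PlanarFilament.barR_arcHierarchy I, PlanarFilament.isRecursionOperator_arcHierarchy I,
      PlanarFilament.lie_eq_zero_of_isRecursionOperator (PlanarFilament.barR_arcHierarchy I)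
        (PlanarFilament.isRecursionOperator_arcHierarchy I), ?_⟩,
    fun γ s _ => PlanarFilament.vec_planarFilament γ s⟩
  -- Independence needs at least one curve on which to evaluate. The straight segment serves; the
  -- non-empty interior of `I` makes its one-sided derivatives well defined.
  exact LinearIndependent.of_comp (PlanarFilament.atCurve (PlanarFilament.PlaneCurve.line hd))
    PlanarFilament.linearIndependent_hierarchy
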